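/- Let $n\ge 1$, let $e_1,\dots,e_n\in\mathbb{Z}[x_1,\dots,x_n]$ be the elementary symmetric polynomials, let $J=\langle e_1,\dots,e_n\rangle$, and let $R=\mathbb{Z}[x_1,\dots,x_n]/J$, graded by polynomial degree. (By Borel's presentation, $R$ is the integral cohomology ring $H^*(GL_n(\mathbb{C})/B)$ of the complete flag variety, with degree-$d$ part $R_d\cong H^{2d}(GL_n(\mathbb{C})/B;\mathbb{Z})$.) The nilpotence order of a nilpotent element $f$ is the smallest integer $k\ge 0$ such that $f^k=0$. Let $f\in R_1$ be nonzero. Then $f$ is nilpotent, its nilpotence order is at least $n$, and its nilpotence order is exactly $n$ if and only if there are $i\in\{1,\dots,n\}$ and $c\in\mathbb{Z}$ such that $f$ is the class modulo $J$ of $c\,x_i$. -/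

import Mathlib

namespace FlagCohomology

/-- The ideal `J = ⟨e_1, …, e_n⟩` of `ℤ[x_1, …, x_n]` generated by the elementary symmetric
polynomials of positive degree; the variable `x_{i+1}` is indexed by `i : Fin n`. -/
noncomputable def J (n : ℕ) : Ideal (MvPolynomial (Fin n) ℤ) :=
  Ideal.span {p | ∃ i : ℕ, 1 ≤ i ∧ i ≤ n ∧ p = MvPolynomial.esymm (Fin n) ℤ i}

/-- The ring `ℤ[x_1, …, x_n] / J`, the integral cohomology ring of the complete flag variety
`GL_n / B` in the Borel presentation. -/
abbrev CohomologyRing (n : ℕ) : Type :=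
  MvPolynomial (Fin n) ℤ ⧸ J n

/-- The class of a variable in `ℤ[x_1, …, x_n] / J`. -/
noncomputable def x {n : ℕ} (i : Fin n) : CohomologyRing n :=
  Ideal.Quotient.mk (J n) (MvPolynomial.X i)

/-- The graded piece of (polynomial) degree `d`, that is `H^{2d}(GL_n / B)`: the image of the
homogeneous polynomials of degree `d`. -/
noncomputable def degreePart (n d : ℕ) : Submodule ℤ (CohomologyRing n) :=
  (MvPolynomial.homogeneousSubmodule (Fin n) ℤ d).map (Ideal.Quotient.mkₐ ℤ (J n)).toLinearMap

end FlagCohomology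

/-!
Polynomials act on polynomials as differential operators with constant coefficients, `x_i` acting
as `∂/∂x_i`. A symmetric polynomial `p` without constant term kills the Vandermonde polynomial `Δ`:
`p(∂) Δ` is alternating, hence supported on exponents with distinct entries, but its degree is
smaller than that of any such exponent. So `ℓ ^ k ∈ J` forces `ℓ(∂) ^ k Δ = 0`. For a linear form
`ℓ = ∑ a_i x_i`, the derivation `ℓ(∂)` sends the factor `x_j - x_i` of `Δ` to the constant
`a_j - a_i`, so by the Leibniz rule `ℓ(∂) ^ k Δ ≠ 0` as long as `k` is at most the number of pairs
`i < j` with `a_i ≠ a_j`. The nilpotence order of `ℓ` therefore exceeds this number, which is at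
least `n - 1` when exactly one `a_i` differs from the common value of the others, and at least `n`
when no `n - 1` of the `a_i` coincide. In the first case `e_1 = 0` turns `ℓ` into a multiple of
`x_i`, and `∏ (t - x_j) = t ^ n` modulo `J` gives `x_i ^ n = 0`.
-/

namespace FlagCohomology

open MvPolynomial Finset

section DiffOp

variable {σ R : Type*} [CommRing R]

theorem pderiv_comm (i j : σ) (p : MvPolynomial σ R) :
    pderiv i (pderiv j p) = pderiv j (pderiv i p) := by
  classical
  let D (k : σ) : Derivation R (MvPolynomial σ R) (MvPolynomial σ R) := pderiv k
  have hbracket : ⁅D i, D j⁆ = 0 :=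
    derivation_ext fun k => by
      simp [D, Derivation.commutator_apply, pderiv_X, Pi.single_apply, apply_ite]
  simpa [D, Derivation.commutator_apply, sub_eq_zero] using DFunLike.congr_fun hbracket p

open scoped IsMulCommutative in
/-- The action of polynomials on polynomials as differential operators with constant coefficients,
`X i` acting as `∂/∂xᵢ`. Evaluating a polynomial needs a commutative target, so the values are taken
in the subalgebra of endomorphisms generated by the partial derivatives. -/
noncomputable def diffOp (σ R : Type*) [CommRing R] :
    MvPolynomial σ R →ₐ[R] Module.End R (MvPolynomial σ R) :=
  let partials : Set (Module.End R (MvPolynomial σ R)) :=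
    Set.range fun i => (pderiv i).toLinearMap
  have : IsMulCommutative (Algebra.adjoin R partials) := Algebra.isMulCommutative_adjoin R <| by
    rintro _ ⟨i, rfl⟩ _ ⟨j, rfl⟩
    exact LinearMap.ext (pderiv_comm i j)
  (Algebra.adjoin R partials).val.comp
    (aeval fun i => ⟨_, Algebra.subset_adjoin (Set.mem_range_self i)⟩)

@[simp]
theorem diffOp_X (i : σ) (p : MvPolynomial σ R) : diffOp σ R (X i) p = pderiv i p := by
  simp [diffOp]

@[simp]
theorem diffOp_C (r : R) (p : MvPolynomial σ R) : diffOp σ R (C r) p = r • p := by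
  rw [← algebraMap_eq, AlgHom.commutes, Module.algebraMap_end_apply]

theorem rename_diffOp {τ : Type*} (e : σ ≃ τ) (p h : MvPolynomial σ R) :
    rename e (diffOp σ R p h) = diffOp τ R (rename e p) (rename e h) := by
  induction p using MvPolynomial.induction_on generalizing h with
  | C r => simp
  | add p q hp hq => simp [hp, hq]
  | mul_X p i hp => simp [hp, pderiv_rename e.injective]

theorem coeff_add_ne_zero_of_coeff_diffOp_monomial_ne_zero {d e : σ →₀ ℕ} {r : R}
    {h : MvPolynomial σ R} (hd : coeff d (diffOp σ R (monomial e r) h) ≠ 0) :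
    coeff (d + e) h ≠ 0 := by
  classical
  induction e using Finsupp.induction_linear generalizing d r h with
  | zero =>
    rw [← C_apply, diffOp_C, coeff_smul] at hd
    simpa using right_ne_zero_of_mul hd
  | add e₁ e₂ ih₁ ih₂ =>
    rw [← one_mul r, ← monomial_mul, map_mul, Module.End.mul_apply] at hd
    rw [← add_assoc]
    exact ih₂ (ih₁ hd)
  | single i k =>
    rw [← C_mul_X_pow_eq_monomial, map_mul, Module.End.mul_apply, diffOp_C, coeff_smul] at hd
    replace hd := right_ne_zero_of_mul hd
    induction k generalizing d with
    | zero => simpa using hd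
    | succ k ih =>
      rw [pow_succ', map_mul, Module.End.mul_apply, diffOp_X, coeff_pderiv] at hd
      rw [add_comm k, Finsupp.single_add, ← add_assoc]
      exact ih (left_ne_zero_of_mul hd)

theorem exists_coeff_add_ne_zero_of_coeff_diffOp_ne_zero {d : σ →₀ ℕ} {p h : MvPolynomial σ R}
    (hd : coeff d (diffOp σ R p h) ≠ 0) : ∃ e, coeff e p ≠ 0 ∧ coeff (d + e) h ≠ 0 := by
  rw [p.as_sum, map_sum, LinearMap.sum_apply, coeff_sum] at hd
  obtain ⟨e, he, hne⟩ := exists_ne_zero_of_sum_ne_zero hd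
  exact ⟨e, mem_support_iff.1 he, coeff_add_ne_zero_of_coeff_diffOp_monomial_ne_zero hne⟩

end DiffOp

section Alternating

variable {σ R : Type*} [CommRing R] [Fintype σ] [DecidableEq σ]

/-- A polynomial is alternating if permuting its variables multiplies it by the sign of the
permutation. -/
def IsAlternating (h : MvPolynomial σ R) : Prop :=
  ∀ e : Equiv.Perm σ, rename e h = (Equiv.Perm.sign e : ℤ) • h

namespace IsAlternating

variable {h : MvPolynomial σ R}

theorem diffOp_of_isSymmetric {p : MvPolynomial σ R} (hp : p.IsSymmetric) (hh : IsAlternating h) :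
    IsAlternating (diffOp σ R p h) := fun e => by
  rw [rename_diffOp, hp, hh, map_zsmul]

theorem injective_of_coeff_ne_zero [IsAddTorsionFree R] (hh : IsAlternating h) {d : σ →₀ ℕ}
    (hd : coeff d h ≠ 0) : Function.Injective d := by
  intro i j hij
  by_contra hne
  have hfix : d.mapDomain (Equiv.swap i j) = d := by
    ext k
    rw [← Finsupp.equivMapDomain_eq_mapDomain, Finsupp.equivMapDomain_apply, Equiv.symm_swap,
      Equiv.swap_apply_def]
    split_ifs with hki hkj
    · rw [hki, hij]
    · rw [hkj, hij]
    · rfl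
  have hneg : -coeff d h = coeff d h := by
    have hswap := coeff_rename_mapDomain _ (Equiv.swap i j).injective h d
    rwa [hfix, hh, Equiv.Perm.sign_swap hne, Units.val_neg, Units.val_one, neg_one_smul,
      coeff_neg] at hswap
  exact hd (neg_eq_self.1 hneg)

end IsAlternating

theorem sum_range_le_sum_of_injective {n : ℕ} {d : Fin n → ℕ} (hd : Function.Injective d) :
    ∑ i ∈ range n, i ≤ ∑ i, d i := by
  have hd' : Function.Injective fun i => (d i : ℤ) := Nat.cast_injective.comp hd
  have h := sum_range_le_sum (s := univ.image fun i => (d i : ℤ)) (c := 0) (by simp)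
  simp only [card_image_of_injective _ hd', card_univ, Fintype.card_fin, zero_add,
    sum_image hd'.injOn] at h
  zify
  exact h

theorem IsAlternating.diffOp_eq_zero [IsAddTorsionFree R] {n : ℕ} {p h : MvPolynomial (Fin n) R}
    (halt : IsAlternating h) (hdeg : h.IsHomogeneous (∑ i ∈ range n, i)) (hp : p.IsSymmetric)
    (hp0 : constantCoeff p = 0) : diffOp (Fin n) R p h = 0 := by
  ext d
  rw [coeff_zero]
  by_contra hd
  obtain ⟨e, hep, heh⟩ := exists_coeff_add_ne_zero_of_coeff_diffOp_ne_zero hd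
  have he : e.degree ≠ 0 := by
    rw [Ne, Finsupp.degree_eq_zero_iff]
    rintro rfl
    exact hep hp0
  have hsum : d.degree + e.degree = ∑ i ∈ range n, i := by
    rw [← map_add]
    exact not_imp_comm.1 hdeg.coeff_eq_zero heh
  have hmin : ∑ i ∈ range n, i ≤ d.degree := by
    rw [Finsupp.degree_eq_sum]
    exact sum_range_le_sum_of_injective
      ((halt.diffOp_of_isSymmetric hp).injective_of_coeff_ne_zero hd)
  omega

end Alternating

section Vandermonde

variable (n : ℕ) (R : Type*) [CommRing R]

/-- The Vandermonde polynomial `∏_{i < j} (x_j - x_i)`. -/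
noncomputable def vandermondePoly : MvPolynomial (Fin n) R :=
  (Matrix.vandermonde X).det

theorem vandermondePoly_eq_prod :
    vandermondePoly n R = ∏ p : Fin n × Fin n with p.1 < p.2, (X p.2 - X p.1) := by
  rw [vandermondePoly, Matrix.det_vandermonde, prod_filter, Fintype.prod_prod_type]
  refine prod_congr rfl fun i _ => ?_
  rw [← prod_filter, filter_lt_eq_Ioi]

theorem isAlternating_vandermondePoly : IsAlternating (vandermondePoly n R) := fun e => by
  rw [vandermondePoly, zsmul_eq_mul, ← Matrix.det_permute, AlgHom.map_det]
  congr 1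
  ext i j : 2
  simp [Matrix.vandermonde_apply]

theorem isHomogeneous_vandermondePoly :
    (vandermondePoly n R).IsHomogeneous (∑ i ∈ range n, i) := by
  have hdeg : ∑ i ∈ range n, i = ∑ i : Fin n, ∑ _j ∈ Ioi i, 1 := by
    simp only [sum_const, Fin.card_Ioi, smul_eq_mul, mul_one]
    rw [← Finset.sum_range_reflect, Finset.sum_range]
  rw [vandermondePoly, Matrix.det_vandermonde, hdeg]
  exact IsHomogeneous.prod _ _ _ fun i _ => IsHomogeneous.prod _ _ _ fun j _ =>
    (isHomogeneous_X _ _).sub (isHomogeneous_X _ _)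

end Vandermonde

section IteratedDerivation

variable {R A ι : Type*} [CommRing R] [CommRing A] [Algebra R A] (D : Derivation R A A)

theorem derivation_prod_eq_zero {l : ι → A} {s : Finset ι} (hl : ∀ i ∈ s, D (l i) = 0) :
    D (∏ i ∈ s, l i) = 0 :=
  prod_induction _ (fun a => D a = 0) (fun a b ha hb => by simp [ha, hb]) D.map_one_eq_zero hl

theorem iterate_derivation_mul_of_eq_zero {g : A} (hg : D g = 0) (h : A) (k : ℕ) :
    D^[k] (g * h) = g * D^[k] h := by
  induction k with
  | zero => rfl
  | succ k ih => simp [Function.iterate_succ_apply', ih, hg]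

theorem iterate_succ_derivation_mul {l : A} (hl : D (D l) = 0) (h : A) (k : ℕ) :
    D^[k + 1] (l * h) = l * D^[k + 1] h + (k + 1) * D l * D^[k] h := by
  induction k with
  | zero =>
    simp only [zero_add, Function.iterate_one, Function.iterate_zero, id_eq, Derivation.leibniz,
      smul_eq_mul, Nat.cast_zero]
    ring
  | succ k ih =>
    rw [Function.iterate_succ_apply', ih]
    simp only [map_add, Derivation.leibniz, hl, smul_eq_mul, Function.iterate_succ_apply',
      Derivation.map_natCast, Derivation.map_one_eq_zero, mul_zero]
    push_cast
    ring

theorem iterate_derivation_prod {l : ι → A} {s : Finset ι} (hl : ∀ i ∈ s, D (D (l i)) = 0) :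
    D^[#s] (∏ i ∈ s, l i) = (#s).factorial * ∏ i ∈ s, D (l i) := by
  classical
  induction s using Finset.induction_on with
  | empty => simp
  | insert i s hi ih =>
    obtain ⟨hli, hls⟩ := forall_mem_insert _ _ _ |>.1 hl
    have hconst : D (∏ j ∈ s, D (l j)) = 0 := derivation_prod_eq_zero D hls
    rw [prod_insert hi, card_insert_of_notMem hi, iterate_succ_derivation_mul D hli,
      Function.iterate_succ_apply', ih hls, prod_insert hi, Nat.factorial_succ]
    simp only [Derivation.leibniz, Derivation.map_natCast, hconst, smul_zero, add_zero, mul_zero,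
      zero_add]
    push_cast
    ring

theorem iterate_derivation_prod_ne_zero [DecidableEq A] [IsDomain A] [CharZero A] {l : ι → A}
    {s : Finset ι} (hl : ∀ i ∈ s, D (D (l i)) = 0) (hl0 : ∀ i ∈ s, l i ≠ 0) :
    D^[#{i ∈ s | D (l i) ≠ 0}] (∏ i ∈ s, l i) ≠ 0 := by
  have hker : D (∏ i ∈ s with ¬ D (l i) ≠ 0, l i) = 0 :=
    derivation_prod_eq_zero D fun i hi => not_not.1 (mem_filter.1 hi).2
  rw [← prod_filter_not_mul_prod_filter s (fun i => D (l i) ≠ 0),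
    iterate_derivation_mul_of_eq_zero D hker,
    iterate_derivation_prod D fun i hi => hl i (mem_filter.1 hi).1]
  refine mul_ne_zero (prod_ne_zero_iff.2 fun i hi => hl0 i (mem_filter.1 hi).1)
    (mul_ne_zero (Nat.cast_ne_zero.2 (Nat.factorial_ne_zero _))
      (prod_ne_zero_iff.2 fun i hi => (mem_filter.1 hi).2))

end IteratedDerivation

section SeparatedPairs

theorem exists_eq_off_or_forall_exists_ne {ι α : Type*} (a : ι → α) :
    (∃ i b, ∀ j ≠ i, a j = b) ∨ ∀ i, ∃ j k, j ≠ k ∧ a i ≠ a j ∧ a i ≠ a k := by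
  by_contra! h
  obtain ⟨hoff, i, hi⟩ := h
  obtain ⟨j, _, hja⟩ := hoff i (a i)
  obtain ⟨k, hk, hka⟩ := hoff j (a i)
  exact hka (hi j k hk.symm hja.symm).symm

variable {ι α : Type*} [Fintype ι] [LinearOrder ι] [DecidableEq α] (a : ι → α)

/-- The pairs `i < j` on which the family `a` takes distinct values. -/
def separatedPairs : Finset (ι × ι) :=
  {p | p.1 < p.2 ∧ a p.1 ≠ a p.2}

theorem two_mul_card_separatedPairs :
    2 * #(separatedPairs a) = ∑ i, #{j | a i ≠ a j} := by
  have hsep : #(separatedPairs a) = ∑ i, ∑ j, if i < j ∧ a i ≠ a j then 1 else 0 := by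
    rw [separatedPairs, card_filter, Fintype.sum_prod_type]
  have hsplit (i j : ι) : (if a i ≠ a j then 1 else 0) =
      (if i < j ∧ a i ≠ a j then 1 else 0) + if j < i ∧ a j ≠ a i then 1 else 0 := by
    rcases lt_trichotomy i j with h | rfl | h
    · simp [h, h.not_gt]
    · simp
    · simp [h, h.not_gt, ne_comm]
  simp_rw [card_filter, hsplit, sum_add_distrib]
  rw [sum_comm (f := fun i j => if j < i ∧ a j ≠ a i then 1 else 0), ← hsep, two_mul]

variable {a}

theorem card_le_card_separatedPairs (h : ∀ i, ∃ j k, j ≠ k ∧ a i ≠ a j ∧ a i ≠ a k) :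
    Fintype.card ι ≤ #(separatedPairs a) := by
  have htwo (i : ι) : 2 ≤ #{j | a i ≠ a j} := by
    obtain ⟨j, k, hjk, hj, hk⟩ := h i
    exact one_lt_card.2 ⟨j, by simpa using hj, k, by simpa using hk, hjk⟩
  have hsum : Fintype.card ι * 2 ≤ ∑ i, #{j | a i ≠ a j} := by
    simpa using card_nsmul_le_sum univ _ 2 fun i _ => htwo i
  rw [← two_mul_card_separatedPairs] at hsum
  omega

theorem card_sub_one_le_card_separatedPairs {i : ι} (h : ∀ j ≠ i, a j ≠ a i) :
    Fintype.card ι - 1 ≤ #(separatedPairs a) := by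
  rw [← card_univ, ← card_erase_of_mem (mem_univ i)]
  refine card_le_card_of_injOn (fun j => (min i j, max i j)) ?_ ?_
  · intro j hj
    have hne : j ≠ i := ne_of_mem_erase hj
    have hval := h j hne
    rcases hne.lt_or_gt with hji | hij
    · simpa [separatedPairs, hji.le, hji] using hval
    · simpa [separatedPairs, hij.le, hij] using hval.symm
  · grind [Set.InjOn]

end SeparatedPairs

section LinearForm

variable {σ R : Type*} [Fintype σ] [CommRing R]

/-- The linear form `∑ aᵢ xᵢ`. -/
noncomputable def linearForm (a : σ → R) : MvPolynomial σ R :=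
  ∑ i, a i • X i

theorem exists_eq_linearForm_of_isHomogeneous_one {ℓ : MvPolynomial σ R}
    (hℓ : ℓ.IsHomogeneous 1) : ∃ a, ℓ = linearForm a := by
  rw [← mem_homogeneousSubmodule, homogeneousSubmodule_one_eq_span_X,
    Submodule.mem_span_range_iff_exists_fun] at hℓ
  exact hℓ.imp fun _ => Eq.symm

theorem diffOp_linearForm (a : σ → R) (h : MvPolynomial σ R) :
    diffOp σ R (linearForm a) h = mkDerivation R (fun i => C (a i)) h := by
  classical
  have hsum (p : MvPolynomial σ R) : diffOp σ R (linearForm a) p = ∑ i, a i • pderiv i p := by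
    simp [linearForm]
  rw [hsum]
  induction h using MvPolynomial.induction_on with
  | C r => simp
  | add p q hp hq => simp [hp, hq, sum_add_distrib]
  | mul_X p j hp =>
    simp [pderiv_X, Pi.single_apply, ← hp, sum_add_distrib, mul_sum, smul_eq_C_mul,
      mul_left_comm, mul_comm p]

theorem diffOp_linearForm_pow (a : σ → R) (k : ℕ) (h : MvPolynomial σ R) :
    diffOp σ R (linearForm a ^ k) h = (mkDerivation R fun i => C (a i))^[k] h := by
  rw [map_pow, Module.End.pow_apply, funext (diffOp_linearForm a)]

theorem diffOp_linearForm_pow_vandermondePoly_ne_zero [DecidableEq R] [IsDomain R] [CharZero R]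
    {n : ℕ} (a : Fin n → R) :
    diffOp (Fin n) R (linearForm a ^ #(separatedPairs a)) (vandermondePoly n R) ≠ 0 := by
  classical
  let D : Derivation R _ (MvPolynomial (Fin n) R) := mkDerivation R fun i => C (a i)
  have hD (p : Fin n × Fin n) : D (X p.2 - X p.1) = C (a p.2 - a p.1) := by
    simp [D, mkDerivation_X]
  have hDD (p : Fin n × Fin n) : D (D (X p.2 - X p.1)) = 0 := by
    rw [hD, derivation_C]
  have hsep : separatedPairs a =
      {p ∈ ({p | p.1 < p.2} : Finset (Fin n × Fin n)) | D (X p.2 - X p.1) ≠ 0} := by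
    rw [separatedPairs, filter_filter]
    refine filter_congr fun p _ => and_congr_right fun _ => ?_
    rw [hD, Ne, Ne, C_eq_zero, sub_eq_zero, eq_comm]
  rw [diffOp_linearForm_pow, vandermondePoly_eq_prod, hsep]
  refine iterate_derivation_prod_ne_zero D (fun p _ => hDD p) fun p hp => ?_
  exact sub_ne_zero.2 (X_injective.ne (mem_filter.1 hp).2.ne')

end LinearForm

section CoinvariantAlgebra

theorem pow_card_eq_zero_of_esymm_eq_zero {A : Type*} [CommRing A] {s : Multiset A}
    (hs : ∀ k, 1 ≤ k → k ≤ s.card → s.esymm k = 0) {a : A} (ha : a ∈ s) : a ^ s.card = 0 := by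
  have hprod : (s.map fun b => Polynomial.X - Polynomial.C b).prod = Polynomial.X ^ s.card := by
    rw [s.prod_X_sub_X_eq_sum_esymm, sum_eq_single 0]
    · simp [Multiset.esymm]
    · intro k hk hk0
      rw [hs k (Nat.one_le_iff_ne_zero.2 hk0) (mem_range_succ_iff.1 hk)]
      simp
    · simp
  have hroot : (Polynomial.X ^ s.card).IsRoot a := by
    rw [← Polynomial.dvd_iff_isRoot, ← hprod]
    exact Multiset.dvd_prod (Multiset.mem_map_of_mem _ ha)
  simpa using hroot

variable (n : ℕ) (R : Type*) [CommRing R]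

/-- The analogue of `J n` over an arbitrary ring of coefficients: the quotient by this ideal is the
coinvariant algebra of the symmetric group, and `J n` is the case `R = ℤ`. -/
noncomputable def coinvariantIdeal : Ideal (MvPolynomial (Fin n) R) :=
  Ideal.span {p | ∃ k : ℕ, 1 ≤ k ∧ k ≤ n ∧ p = esymm (Fin n) R k}

variable {n R}

local notation "π" => Ideal.Quotient.mk (coinvariantIdeal n R)

theorem mk_esymm {k : ℕ} (hk : 1 ≤ k) (hkn : k ≤ n) : π (esymm (Fin n) R k) = 0 :=
  Ideal.Quotient.eq_zero_iff_mem.2 (Ideal.subset_span ⟨k, hk, hkn, rfl⟩)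

theorem mk_X_pow_eq_zero (i : Fin n) : π (X i) ^ n = 0 := by
  have hesymm (k : ℕ) : (univ.val.map fun j => π (X j)).esymm k = π (esymm (Fin n) R k) := by
    rw [← aeval_esymm_eq_multiset_esymm (Fin n) R]
    exact (DFunLike.congr_fun (aeval_unique (Ideal.Quotient.mkₐ R (coinvariantIdeal n R))) _).symm
  simpa using pow_card_eq_zero_of_esymm_eq_zero (s := univ.val.map fun j => π (X j))
    (fun k hk hkn => by rw [hesymm, mk_esymm hk (by simpa using hkn)])
    (Multiset.mem_map_of_mem _ (mem_univ i))

theorem mk_linearForm (a : Fin n → R) : π (linearForm a) = ∑ i, a i • π (X i) := by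
  rw [linearForm, map_sum]
  rfl

theorem isNilpotent_mk_linearForm (a : Fin n → R) : IsNilpotent (π (linearForm a)) := by
  rw [mk_linearForm]
  exact isNilpotent_sum fun i _ => IsNilpotent.smul ⟨n, mk_X_pow_eq_zero i⟩ (a i)

theorem mk_linearForm_eq_smul_mk_X {a : Fin n → R} {i : Fin n} {b : R}
    (h : ∀ j ≠ i, a j = b) : π (linearForm a) = (a i - b) • π (X i) := by
  have hsum : ∑ j, π (X j) = 0 := by
    rw [← map_sum, ← esymm_one, mk_esymm le_rfl i.pos]
  calc π (linearForm a) = ∑ j, (a j - b) • π (X j) := by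
        rw [mk_linearForm]
        simp_rw [sub_smul, sum_sub_distrib, ← smul_sum, hsum, smul_zero, sub_zero]
    _ = (a i - b) • π (X i) :=
        sum_eq_single i (fun j _ hj => by rw [h j hj, sub_self, zero_smul]) (by simp)

theorem diffOp_vandermondePoly_eq_zero_of_mem [IsAddTorsionFree R] {p : MvPolynomial (Fin n) R}
    (hp : p ∈ coinvariantIdeal n R) : diffOp (Fin n) R p (vandermondePoly n R) = 0 := by
  induction hp using Submodule.span_induction with
  | mem p hp =>
    obtain ⟨k, hk, -, rfl⟩ := hp
    have hconst : constantCoeff (esymm (Fin n) R k) = 0 := by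
      rw [esymm, map_sum]
      refine sum_eq_zero fun t ht => ?_
      simp [(mem_powersetCard.1 ht).2, Nat.one_le_iff_ne_zero.1 hk]
    exact (isAlternating_vandermondePoly n R).diffOp_eq_zero (isHomogeneous_vandermondePoly n R)
      (esymm_isSymmetric _ _ k) hconst
  | zero => simp
  | add p q _ _ hp hq => simp [hp, hq]
  | smul a p _ hp => rw [smul_eq_mul, map_mul, Module.End.mul_apply, hp, map_zero]

theorem card_separatedPairs_lt_nilpotencyClass [DecidableEq R] [IsDomain R] [CharZero R]
    (a : Fin n → R) : #(separatedPairs a) < nilpotencyClass (π (linearForm a)) := by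
  by_contra! hle
  have hpow : π (linearForm a ^ #(separatedPairs a)) = 0 := by
    rw [map_pow]
    exact pow_eq_zero_of_le hle (pow_nilpotencyClass (isNilpotent_mk_linearForm a))
  exact diffOp_linearForm_pow_vandermondePoly_ne_zero a
    (diffOp_vandermondePoly_eq_zero_of_mem (Ideal.Quotient.eq_zero_iff_mem.1 hpow))

theorem nilpotencyClass_smul_mk_X_le (c : R) (i : Fin n) : nilpotencyClass (c • π (X i)) ≤ n :=
  Nat.sInf_le (by rw [Set.mem_ofPred_eq, smul_pow, mk_X_pow_eq_zero, smul_zero])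

end CoinvariantAlgebra

end FlagCohomology

open FlagCohomology MvPolynomial in
theorem theorem4p1_general {R : Type*} [CommRing R] [IsDomain R] [CharZero R] {n : ℕ}
    {ℓ : MvPolynomial (Fin n) R} (hℓ : ℓ.IsHomogeneous 1)
    (hℓ0 : Ideal.Quotient.mk (coinvariantIdeal n R) ℓ ≠ 0) :
    IsNilpotent (Ideal.Quotient.mk (coinvariantIdeal n R) ℓ) ∧
      n ≤ nilpotencyClass (Ideal.Quotient.mk (coinvariantIdeal n R) ℓ) ∧
      (nilpotencyClass (Ideal.Quotient.mk (coinvariantIdeal n R) ℓ) = n ↔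
        ∃ (i : Fin n) (c : R), Ideal.Quotient.mk (coinvariantIdeal n R) ℓ =
          c • Ideal.Quotient.mk (coinvariantIdeal n R) (X i)) := by
  classical
  obtain ⟨a, rfl⟩ := exists_eq_linearForm_of_isHomogeneous_one hℓ
  have hlt := card_separatedPairs_lt_nilpotencyClass a
  refine ⟨isNilpotent_mk_linearForm a, ?_⟩
  rcases exists_eq_off_or_forall_exists_ne a with ⟨i, b, hb⟩ | hsep
  · have heq := mk_linearForm_eq_smul_mk_X hb
    have hab : a i ≠ b := fun h => hℓ0 (by rw [heq, h, sub_self, zero_smul])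
    have hcard := card_sub_one_le_card_separatedPairs fun j hj => (hb j hj).trans_ne hab.symm
    rw [Fintype.card_fin] at hcard
    have hn : n ≤ nilpotencyClass (Ideal.Quotient.mk (coinvariantIdeal n R) (linearForm a)) := by
      omega
    exact ⟨hn, fun _ => ⟨i, _, heq⟩, fun _ => hn.antisymm' (heq ▸ nilpotencyClass_smul_mk_X_le _ i)⟩
  · have hn := (card_le_card_separatedPairs hsep).trans_lt hlt
    rw [Fintype.card_fin] at hn
    refine ⟨hn.le, fun h => absurd h hn.ne', ?_⟩
    rintro ⟨i, c, hc⟩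
    exact absurd (hc ▸ nilpotencyClass_smul_mk_X_le c i) hn.not_ge

theorem theorem4p1 (n : ℕ) (f : FlagCohomology.CohomologyRing n)
    (hf : f ∈ FlagCohomology.degreePart n 1) (hf0 : f ≠ 0) :
    IsNilpotent f ∧ n ≤ nilpotencyClass f ∧
      (nilpotencyClass f = n ↔ ∃ (i : Fin n) (c : ℤ), f = c • FlagCohomology.x i) := by
  obtain ⟨ℓ, hℓ, rfl⟩ := hf
  exact theorem4p1_general hℓ hf0
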